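/- For $n \ge 1$ let $\mathbb{I}_n$ be the $n$-dimensional hypercube graph: its vertices are the binary strings of length $n$, two of them being adjacent if and only if they differ in exactly one position. Let $\mathcal{N}(\mathbb{I}_n,3)$ be its \v{C}ech complex at scale $3$, that is, the nerve of the family of all closed balls of radius $\frac{3}{2}$ centered at vertices of $\mathbb{I}_n$, where the balls are drawn in the geometric realization of $\mathbb{I}_n$ with the shortest path metric in which every edge has length $1$. For a finite simplicial complex $X$ and an integer $d \ge 0$, an elementary $d$-collapse of $X$ deletes from $X$ all simplices $\delta$ with $\sigma \subseteq \delta \subseteq \gamma$, where $\sigma \in X$ is a simplex with at most $d$ vertices that is contained in a unique maximal simplex $\gamma$ of $X$ (the case $\sigma=\gamma$ is allowed). $X$ is $d$-collapsible if some finite sequence of elementary $d$-collapses leads from $X$ to the void complex $\emptyset$. The collapsibility number of $X$ is the minimal $d$ such that $X$ is $d$-collapsible. Theorem. For every $n \ge 4$, the collapsibility number of $\mathcal{N}(\mathbb{I}_n,3)$ is exactly $5$. In particular, $\mathcal{N}(\mathbb{I}_n,3)$ is homotopy equivalent to a finite simplicial complex of dimension at most $4$. -/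

import Mathlib

/-!
Finite abstract simplicial complexes are Mathlib's `PreAbstractSimplicialComplex`; its faces are
the nonempty simplices, the empty simplex being left implicit.
-/

namespace CechHypercube

/-- The geometric realization of an abstract simplicial complex `K` with finitely many vertices,
as a subspace of `ℝ^V`: points given by barycentric coordinates whose support spans a simplex. -/
def realization {V : Type*} [Fintype V] (K : PreAbstractSimplicialComplex V) : Set (V → ℝ) :=
  {x | x ∈ stdSimplex ℝ V ∧ ∃ σ ∈ K.faces, ∀ v, x v ≠ 0 → v ∈ σ}

/-- The nerve of a family of sets: a nonempty finite set `σ` of indices is a simplex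
if the sets indexed by `σ` have a common point. -/
def nerveComplex {ι X : Type*} (U : ι → Set X) : PreAbstractSimplicialComplex ι where
  faces := {σ | σ.Nonempty ∧ ∃ x, ∀ i ∈ σ, x ∈ U i}
  isRelLowerSet_faces := by
    rintro σ ⟨hσ, x, hx⟩
    exact ⟨hσ, fun τ hτ hne => ⟨hne, x, fun i hi => hx i (hτ hi)⟩⟩

/-- The geometric realization of a finite simple graph, every edge being a segment. -/
def graphRealization {V : Type*} [Fintype V] [DecidableEq V] (G : SimpleGraph V) :
    Set (V → ℝ) :=
  realization (Geometry.AbstractSimplicialComplex.ofSimpleGraph G).toPreAbstractSimplicialComplex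

/-- The closed ball of radius `ρ` around the vertex `w` in the geometric realization of `G`, for
the shortest path metric in which every edge has length `1`. A path from `w` to a point `x` of the
realization runs along a walk of `G` to an endpoint `u` of the edge that carries `x`
(or to `u = x` if `x` is a vertex) and from there along the edge to `x`; this last piece has
length `1 - x u`, because `x u` is the barycentric coordinate of `x` at `u`. -/
def graphClosedBall {V : Type*} [Fintype V] [DecidableEq V] (G : SimpleGraph V) (w : V) (ρ : ℝ) :
    Set (V → ℝ) :=
  {x | x ∈ graphRealization G ∧
    ∃ u, 0 < x u ∧ ∃ p : G.Walk w u, (p.length : ℝ) + (1 - x u) ≤ ρ}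

/-- The Čech complex `𝒩(G, r)`: the nerve of all closed balls of radius `r / 2`, drawn in the
geometric realization of `G`, that are centered at vertices of `G`. -/
def cechComplex {V : Type*} [Fintype V] [DecidableEq V] (G : SimpleGraph V) (r : ℝ) :
    PreAbstractSimplicialComplex V :=
  nerveComplex fun w => graphClosedBall G w (r / 2)

/-- The `n`-dimensional hypercube graph: binary strings of length `n`, adjacent when they differ
in exactly one position. -/
def hypercubeGraph (n : ℕ) : SimpleGraph (Fin n → Bool) where
  Adj x y := hammingDist x y = 1
  symm := ⟨fun x y h => by rwa [hammingDist_comm]⟩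
  loopless := ⟨fun x h => by simp at h⟩

/-- `γ` is a maximal simplex (facet) of `X`. -/
def IsMaximalSimplex {V : Type*} (X : PreAbstractSimplicialComplex V) (γ : Finset V) : Prop :=
  γ ∈ X.faces ∧ ∀ δ ∈ X.faces, γ ⊆ δ → δ = γ

/-- `Y` is obtained from `X` by an elementary `d`-collapse: there is a simplex `σ` of `X` with at
most `d` vertices contained in a unique maximal simplex `γ`, and `Y` arises by deleting all
simplices `δ` with `σ ⊆ δ ⊆ γ`. (That `σ` is a simplex follows from `σ ⊆ γ`; as usual, the empty
simplex is not excluded.) -/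
def IsElementaryCollapse {V : Type*} (d : ℕ) (X Y : PreAbstractSimplicialComplex V) : Prop :=
  ∃ σ γ : Finset V, σ.card ≤ d ∧ σ ⊆ γ ∧ IsMaximalSimplex X γ ∧
    (∀ γ', IsMaximalSimplex X γ' → σ ⊆ γ' → γ' = γ) ∧
    Y.faces = {δ | δ ∈ X.faces ∧ ¬ (σ ⊆ δ ∧ δ ⊆ γ)}

/-- `X` is `d`-collapsible: a finite sequence of elementary `d`-collapses leads from `X` to the
complex without simplices. -/
def IsCollapsible {V : Type*} (d : ℕ) (X : PreAbstractSimplicialComplex V) : Prop :=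
  Relation.ReflTransGen (IsElementaryCollapse d) X ⊥

/-- `c` is the collapsibility number of `X`: the least `d` such that `X` is `d`-collapsible. -/
def IsCollapsibilityNumber {V : Type*} (X : PreAbstractSimplicialComplex V) (c : ℕ) : Prop :=
  IsLeast {d : ℕ | IsCollapsible d X} c

/-- Every simplex of `X` has dimension at most `k`, that is, at most `k + 1` vertices. -/
def DimensionAtMost {V : Type*} (X : PreAbstractSimplicialComplex V) (k : ℕ) : Prop :=
  ∀ σ ∈ X.faces, σ.card ≤ k + 1

end CechHypercube

namespace CechHypercube

open Relation

/-! ### Elementary collapses, missing simplices and transversals -/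

section Collapse

variable {V : Type*}

/-! A point common to several balls lies on an edge, and each center is then within distance 1 of an
endpoint of that edge. Conversely, all such centers reach the midpoint. So the complex is generated
by the stars of edges (`cechComplex_hypercubeGraph_eq`).

Upper bound. Remove the generators one at a time, in any order. The simplices that disappear with
`γ` are those contained in no remaining generator `γ'`, that is, the subsets of `γ` meeting every
difference `γ \ γ'`. A greedy choice of transversals splits them into intervals (`CollapsingTree`).
For edge stars, either `γ ∩ γ'` has at most 4 elements, or `γ \ γ'` is one of two disjoint blocks of
`γ` up to one missing vertex. Hitting all differences of the second kind costs at most two vertices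
per block. A partial transversal missing a difference of the first kind lies in a set of at most 4
elements, so the greedy choice never exceeds 5 vertices (`CollapsingTree.of_blocks`,
`edgeStars_reflTransGen`).

Lower bound. A 3-cube without two antipodal vertices is a missing simplex with 6 vertices all of
whose facets are present; `IsCollapsible.card_le_of_missing` then gives `5 ≤ d`.

Homotopy type. The collapses are pure: an interval has a bottom with exactly 5 vertices or is a
single simplex with at most 5. Perform the collapses of nontrivial intervals, which are homotopy
equivalences, and skip the others. What is left has only simplices with at most 5 vertices
(`exists_homotopyEquiv_of_pureCollapses`). -/

lemma nonempty_of_mem_faces {X : PreAbstractSimplicialComplex V} {δ : Finset V}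
    (h : δ ∈ X.faces) : δ.Nonempty :=
  (X.isRelLowerSet_faces h).1

lemma mem_faces_of_subset {X : PreAbstractSimplicialComplex V} {δ τ : Finset V}
    (h : δ ∈ X.faces) (hτ : τ ⊆ δ) (hne : τ.Nonempty) : τ ∈ X.faces :=
  (X.isRelLowerSet_faces h).2 hτ hne

/-- The complex obtained from `X` by deleting a family `U` of simplices that contains, with each
of its members, all larger simplices of `X`. -/
def deleteFaces (X : PreAbstractSimplicialComplex V) (U : Set (Finset V))
    (hU : ∀ δ ∈ U, ∀ τ ∈ X.faces, δ ⊆ τ → τ ∈ U) : PreAbstractSimplicialComplex V where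
  faces := X.faces \ U
  isRelLowerSet_faces := by
    rintro δ ⟨hδ, hδU⟩
    exact ⟨nonempty_of_mem_faces hδ, fun τ hτ hne =>
      ⟨mem_faces_of_subset hδ hτ hne, fun h => hδU (hU τ h δ hδ hτ)⟩⟩

/-- An elementary collapse that removes an interval `[σ, γ]` in which either `σ` has exactly `d`
vertices, or `σ = γ` has at most `d` vertices. -/
def IsPureCollapse (d : ℕ) (X Y : PreAbstractSimplicialComplex V) : Prop :=
  ∃ σ γ : Finset V, σ ⊆ γ ∧ γ ∈ X.faces ∧ (∀ δ ∈ X.faces, σ ⊆ δ → δ ⊆ γ) ∧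
    (σ.card = d ∨ σ = γ ∧ σ.card ≤ d) ∧
    Y.faces = {δ | δ ∈ X.faces ∧ ¬ (σ ⊆ δ ∧ δ ⊆ γ)}

lemma IsPureCollapse.isElementaryCollapse {d : ℕ} {X Y : PreAbstractSimplicialComplex V}
    (h : IsPureCollapse d X Y) : IsElementaryCollapse d X Y := by
  obtain ⟨σ, γ, hσγ, hγ, hmax, hcard, hY⟩ := h
  refine ⟨σ, γ, by omega, hσγ, ⟨hγ, fun δ hδ h => ?_⟩, fun γ' hγ' h => ?_, hY⟩
  · exact (hmax δ hδ (hσγ.trans h)).antisymm h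
  · exact (hγ'.2 γ hγ (hmax γ' hγ'.1 h)).symm

lemma exists_isMaximalSimplex [Finite V] {X : PreAbstractSimplicialComplex V} {δ : Finset V}
    (h : δ ∈ X.faces) : ∃ γ, δ ⊆ γ ∧ IsMaximalSimplex X γ := by
  obtain ⟨γ, hδγ, hγ⟩ := (Set.toFinite X.faces).exists_le_maximal h
  exact ⟨γ, hδγ, hγ.prop, fun τ hτ hle => (hγ.le_of_ge hτ hle).antisymm hle⟩

/-- A simplex missing from a `d`-collapsible complex that contains all its facets has at most
`d + 1` vertices. -/
lemma IsCollapsible.card_le_of_missing [Finite V] [DecidableEq V] {d : ℕ}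
    {X : PreAbstractSimplicialComplex V} (h : IsCollapsible d X) {τ : Finset V}
    (hτ : τ ∉ X.faces) (hne : τ.Nonempty) (hf : ∀ a ∈ τ, τ.erase a ∈ X.faces) :
    τ.card ≤ d + 1 := by
  induction h using ReflTransGen.head_induction_on with
  | refl =>
    obtain ⟨a, ha⟩ := hne
    exact (hf a ha).elim
  | @head X Y hXY _ ih =>
    obtain ⟨σ, γ, hcard, hσγ, hγ, huniq, hY⟩ := hXY
    by_cases hστ : σ ⊆ τ
    · by_contra! hlt
      have hc : 1 < (τ \ σ).card := by
        have := Finset.card_sdiff_add_card_eq_card hστ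
        omega
      obtain ⟨a, ha, b, hb, hab⟩ := Finset.one_lt_card.mp hc
      -- A facet of `τ` that still contains `σ` must lie in the only maximal simplex over `σ`. Two
      -- such facets cover `τ`.
      have key : ∀ c ∈ τ \ σ, τ.erase c ⊆ γ := by
        intro c hc
        obtain ⟨δ, hδ, hmax⟩ := exists_isMaximalSimplex (hf c (Finset.mem_sdiff.mp hc).1)
        have := huniq δ hmax (fun x hx => hδ (Finset.mem_erase.mpr ⟨by grind, hστ hx⟩))
        exact this ▸ hδ
      have hle : τ ⊆ γ := by
        intro x hx
        by_cases hxa : x = a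
        · exact key b hb (Finset.mem_erase.mpr ⟨hxa ▸ hab, hx⟩)
        · exact key a ha (Finset.mem_erase.mpr ⟨hxa, hx⟩)
      exact hτ (mem_faces_of_subset hγ.1 hle hne)
    · refine ih ?_ ?_
      · rw [hY]
        exact fun h => hτ h.1
      · intro a ha
        rw [hY]
        exact ⟨hf a ha, fun h => hστ (h.1.trans (Finset.erase_subset _ _))⟩

/-- Once `M` is itself a transversal of `𝓓`, so is every set above it. The transversals over `M` in
`X` therefore form the full interval from `M` to `γ`, and one collapse removes them. -/
lemma isPureCollapse_deleteFaces {d : ℕ} {X : PreAbstractSimplicialComplex V} {M γ : Finset V}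
    {𝓓 : Set (Finset V)} (hM : M ⊆ γ) (hcard : M.card = d ∨ M = γ ∧ M.card ≤ d)
    (hit : ∀ D ∈ 𝓓, ¬ Disjoint D M) (hγ : γ.Nonempty)
    (hX : ∀ δ : Finset V, δ.Nonempty → M ⊆ δ → (∀ D ∈ 𝓓, ¬ Disjoint D δ) →
      (δ ∈ X.faces ↔ δ ⊆ γ)) :
    ∃ Y, IsPureCollapse d X Y ∧
      Y.faces = X.faces \ {δ | M ⊆ δ ∧ ∀ D ∈ 𝓓, ¬ Disjoint D δ} := by
  have hmono : ∀ δ : Finset V, M ⊆ δ → ∀ D ∈ 𝓓, ¬ Disjoint D δ :=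
    fun δ hδ D hD h => hit D hD (h.mono_right hδ)
  have hsub : ∀ δ ∈ X.faces, M ⊆ δ → δ ⊆ γ := fun δ hδ h =>
    (hX δ (nonempty_of_mem_faces hδ) h (hmono δ h)).mp hδ
  refine ⟨deleteFaces X {δ | M ⊆ δ ∧ ∀ D ∈ 𝓓, ¬ Disjoint D δ} ?_, ⟨M, γ, hM,
    (hX γ hγ hM (hmono γ hM)).mpr subset_rfl, hsub, hcard, ?_⟩, rfl⟩
  · exact fun δ hδ τ _ h => ⟨hδ.1.trans h, hmono τ (hδ.1.trans h)⟩
  · ext δ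
    constructor
    · rintro ⟨h₁, h₂⟩
      exact ⟨h₁, fun h => h₂ ⟨h.1, hmono δ h.1⟩⟩
    · rintro ⟨h₁, h₂⟩
      exact ⟨h₁, fun h => h₂ ⟨h.1, hsub δ h₁ h.1⟩⟩

variable [DecidableEq V]

/-- A decision tree that splits the simplices `δ` with `M ⊆ δ ⊆ γ` meeting every member of `𝓓`
into intervals removable by pure collapses. -/
inductive CollapsingTree (d : ℕ) (𝓓 : Set (Finset V)) : Finset V → Finset V → Prop
  | full {M γ : Finset V} (hM : M ⊆ γ) (hcard : M.card = d) (hit : ∀ D ∈ 𝓓, ¬ Disjoint D M) :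
      CollapsingTree d 𝓓 M γ
  | point {M : Finset V} (hcard : M.card ≤ d) : CollapsingTree d 𝓓 M M
  | empty {M γ D : Finset V} (hD : D ∈ 𝓓) (hDγ : Disjoint D γ) : CollapsingTree d 𝓓 M γ
  | branch {M γ : Finset V} (v : V) (h₁ : CollapsingTree d 𝓓 (insert v M) γ)
      (h₂ : CollapsingTree d 𝓓 M (γ.erase v)) : CollapsingTree d 𝓓 M γ

/-- The order at a branch matters: after the transversals containing `v` are gone, those left over
`M` avoid `v`, so `γ.erase v` is an upper bound for them. -/
theorem CollapsingTree.reflTransGen {d : ℕ} {𝓓 : Set (Finset V)} {M γ : Finset V}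
    (h : CollapsingTree d 𝓓 M γ) (X : PreAbstractSimplicialComplex V)
    (hX : ∀ δ : Finset V, δ.Nonempty → M ⊆ δ → (∀ D ∈ 𝓓, ¬ Disjoint D δ) →
      (δ ∈ X.faces ↔ δ ⊆ γ)) :
    ∃ Y, ReflTransGen (IsPureCollapse d) X Y ∧
      Y.faces = X.faces \ {δ | M ⊆ δ ∧ ∀ D ∈ 𝓓, ¬ Disjoint D δ} := by
  have trivial_case : ∀ {M γ : Finset V} {X : PreAbstractSimplicialComplex V},
      (∀ δ : Finset V, δ.Nonempty → M ⊆ δ → (∀ D ∈ 𝓓, ¬ Disjoint D δ) →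
      (δ ∈ X.faces ↔ δ ⊆ γ)) →
      (∀ δ ⊆ γ, δ.Nonempty → M ⊆ δ → ∃ D ∈ 𝓓, Disjoint D δ) →
      ∃ Y, ReflTransGen (IsPureCollapse d) X Y ∧
        Y.faces = X.faces \ {δ | M ⊆ δ ∧ ∀ D ∈ 𝓓, ¬ Disjoint D δ} := by
    intro M γ X hX h
    refine ⟨X, .refl, ?_⟩
    ext δ
    refine ⟨fun hδ => ⟨hδ, fun hU => ?_⟩, fun hδ => hδ.1⟩
    have hne := nonempty_of_mem_faces hδ
    obtain ⟨D, hD, hdis⟩ := h δ ((hX δ hne hU.1 hU.2).mp hδ) hne hU.1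
    exact hU.2 D hD hdis
  induction h generalizing X with
  | @full M γ hM hcard hit =>
    rcases γ.eq_empty_or_nonempty with rfl | hγ
    · exact trivial_case hX fun δ hδ hne _ =>
        absurd (Finset.subset_empty.mp hδ) hne.ne_empty
    · obtain ⟨Y, hXY, hY⟩ := isPureCollapse_deleteFaces hM (.inl hcard) hit hγ hX
      exact ⟨Y, .single hXY, hY⟩
  | @point M hcard =>
    by_cases hit : ∀ D ∈ 𝓓, ¬ Disjoint D M
    · rcases M.eq_empty_or_nonempty with rfl | hM
      · exact trivial_case hX fun δ hδ hne _ =>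
          absurd (Finset.subset_empty.mp hδ) hne.ne_empty
      · obtain ⟨Y, hXY, hY⟩ :=
          isPureCollapse_deleteFaces subset_rfl (.inr ⟨rfl, hcard⟩) hit hM hX
        exact ⟨Y, .single hXY, hY⟩
    · push Not at hit
      obtain ⟨D, hD, hdis⟩ := hit
      exact trivial_case hX fun δ hδ _ _ => ⟨D, hD, hdis.mono_right hδ⟩
  | @empty M γ D hD hDγ =>
    exact trivial_case hX fun δ hδ _ _ => ⟨D, hD, hDγ.mono_right hδ⟩
  | @branch M γ v h₁ h₂ ih₁ ih₂ =>
    obtain ⟨X₁, hX₁, hf₁⟩ := ih₁ X fun δ hne hδ hit =>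
      hX δ hne ((Finset.subset_insert v M).trans hδ) hit
    obtain ⟨Y, hY, hf⟩ := ih₂ X₁ fun δ hne hδ hit => by
      have := hX δ hne hδ hit
      rw [hf₁, Finset.subset_erase, ← this]
      constructor
      · rintro ⟨h, hU⟩
        exact ⟨h, fun hv => hU ⟨Finset.insert_subset hv hδ, hit⟩⟩
      · rintro ⟨h, hv⟩
        exact ⟨h, fun hU => hv (hU.1 (Finset.mem_insert_self v M))⟩
    refine ⟨Y, hX₁.trans hY, ?_⟩
    rw [hf, hf₁]
    ext δ
    constructor
    · rintro ⟨⟨h, _⟩, hU⟩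
      exact ⟨h, hU⟩
    · rintro ⟨h, hU⟩
      exact ⟨⟨h, fun hU' => hU ⟨(Finset.subset_insert v M).trans hU'.1, hU'.2⟩⟩, hU⟩

/-- A single interval from `M` to `γ` need not be pure. Branching on further vertices cuts it into
intervals whose bottom has exactly `d` vertices and single simplices with fewer. -/
lemma CollapsingTree.of_hit {d : ℕ} {𝓓 : Set (Finset V)} {M γ : Finset V} (hM : M ⊆ γ)
    (hcard : M.card ≤ d) (hit : ∀ D ∈ 𝓓, ¬ Disjoint D M) : CollapsingTree d 𝓓 M γ := by
  induction hk : (γ \ M).card using Nat.strong_induction_on generalizing M γ with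
  | _ k ih =>
  rcases hM.eq_or_ssubset with rfl | hss
  · exact .point hcard
  rcases hcard.eq_or_lt with hd | hd
  · exact .full hM hd hit
  · obtain ⟨v, hvγ, hvM⟩ := Finset.exists_of_ssubset hss
    refine .branch v (ih _ ?_ (Finset.insert_subset hvγ hM) ?_ ?_ rfl)
      (ih _ ?_ (Finset.subset_erase.mpr ⟨hM, hvM⟩) hcard hit rfl)
    · rw [← hk]
      exact Finset.card_lt_card (Finset.ssubset_iff.mpr ⟨v, by simp, by grind⟩)
    · rw [Finset.card_insert_of_notMem hvM]
      omega
    · exact fun D hD hdis => hit D hD (hdis.mono_right (Finset.subset_insert v M))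
    · rw [← hk]
      exact Finset.card_lt_card (Finset.ssubset_iff.mpr ⟨v, by simp, by grind⟩)

/-- A greedy choice of transversals, with `I` describing the partial transversals, gives a
collapsing tree. -/
lemma CollapsingTree.of_invariant {d : ℕ} {𝓓 : Set (Finset V)} (I : Finset V → Prop)
    (hI : ∀ M, I M → M.card ≤ d ∧ ((∀ D ∈ 𝓓, ¬ Disjoint D M) ∨
      ∃ D ∈ 𝓓, Disjoint D M ∧ ∀ v ∈ D, I (insert v M)))
    {M γ : Finset V} (hM : M ⊆ γ) (h : I M) : CollapsingTree d 𝓓 M γ := by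
  induction hk : (γ \ M).card using Nat.strong_induction_on generalizing M γ with
  | _ k ih =>
  obtain ⟨hcard, hit | ⟨D, hD, hDM, hins⟩⟩ := hI M h
  · exact .of_hit hM hcard hit
  · by_cases hDγ : Disjoint D γ
    · exact .empty hD hDγ
    · obtain ⟨v, hvD, hvγ⟩ := Finset.not_disjoint_iff.mp hDγ
      have hvM : v ∉ M := Finset.disjoint_left.mp hDM hvD
      -- Either `v` hits `D`, or `v` is discarded from `γ`. Repeated discarding ends with `D`
      -- disjoint from `γ`, where no transversal remains.
      refine .branch v (ih _ ?_ (Finset.insert_subset hvγ hM) (hins v hvD) rfl)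
        (ih _ ?_ (Finset.subset_erase.mpr ⟨hM, hvM⟩) h rfl)
      · rw [← hk]
        exact Finset.card_lt_card (Finset.ssubset_iff.mpr ⟨v, by simp, by grind⟩)
      · rw [← hk]
        exact Finset.card_lt_card (Finset.ssubset_iff.mpr ⟨v, by simp, by grind⟩)

/-- The complex generated by a finite family of simplices. -/
def generatedComplex (𝓕 : Finset (Finset V)) : PreAbstractSimplicialComplex V where
  faces := {δ | δ.Nonempty ∧ ∃ γ ∈ 𝓕, δ ⊆ γ}
  isRelLowerSet_faces := by
    rintro δ ⟨hδ, γ, hγ, h⟩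
    exact ⟨hδ, fun τ hτ hne => ⟨hne, γ, hγ, hτ.trans h⟩⟩

/-- A complex collapses if each of its generators has a collapsing tree relative to every family
of other generators. -/
theorem generatedComplex_reflTransGen {d : ℕ} (𝓕 : Finset (Finset V))
    (h : ∀ γ ∈ 𝓕, ∀ 𝓖 ⊆ 𝓕, γ ∉ 𝓖 → CollapsingTree d ((γ \ ·) '' (𝓖 : Set (Finset V))) ∅ γ) :
    ReflTransGen (IsPureCollapse d) (generatedComplex 𝓕) ⊥ := by
  induction 𝓕 using Finset.induction_on with
  | empty =>
    have : generatedComplex (∅ : Finset (Finset V)) = ⊥ := by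
      ext δ
      exact ⟨fun ⟨_, γ, hγ, _⟩ => absurd hγ (Finset.notMem_empty γ), fun h => h.elim⟩
    rw [this]
  | insert γ 𝓖 hγ ih =>
    obtain ⟨Y, hXY, hY⟩ := (h γ (Finset.mem_insert_self γ 𝓖) 𝓖 (Finset.subset_insert γ 𝓖)
      hγ).reflTransGen (generatedComplex (insert γ 𝓖)) (fun δ hne _ hit => by
        refine ⟨?_, fun hδ => ⟨hne, γ, Finset.mem_insert_self γ 𝓖, hδ⟩⟩
        rintro ⟨_, γ', hγ', hδ⟩
        rcases Finset.mem_insert.mp hγ' with rfl | hγ'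
        · exact hδ
        · exact absurd (Finset.disjoint_of_subset_right hδ Finset.sdiff_disjoint)
            (hit (γ \ γ') ⟨γ', hγ', rfl⟩))
    have hYG : Y = generatedComplex 𝓖 := by
      ext δ
      rw [hY]
      constructor
      -- A simplex of `γ` in no member of `𝓖` meets every difference `γ \ γ''`, so it has been
      -- deleted.
      · rintro ⟨⟨hne, γ', hγ', hδ⟩, hU⟩
        refine ⟨hne, ?_⟩
        rcases Finset.mem_insert.mp hγ' with rfl | hγ'
        · by_contra! hall
          refine hU ⟨Finset.empty_subset δ, ?_⟩
          rintro _ ⟨γ'', hγ'', rfl⟩ hdis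
          refine hall γ'' hγ'' fun x hx => ?_
          by_contra hx'
          exact Finset.disjoint_left.mp hdis (Finset.mem_sdiff.mpr ⟨hδ hx, hx'⟩) hx
        · exact ⟨γ', hγ', hδ⟩
      · rintro ⟨hne, γ', hγ', hδ⟩
        exact ⟨⟨hne, γ', Finset.mem_insert_of_mem hγ', hδ⟩, fun hU => hU.2 (γ \ γ')
          ⟨γ', hγ', rfl⟩ (Finset.disjoint_of_subset_right hδ Finset.sdiff_disjoint)⟩
    rw [hYG] at hXY
    exact hXY.trans (ih fun γ' hγ' 𝓗 h𝓗 hn =>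
      h γ' (Finset.mem_insert_of_mem hγ') 𝓗 (h𝓗.trans (Finset.subset_insert γ 𝓖)) hn)

/-- A collapsing tree exists if every member of `𝓓` either is one of two disjoint blocks with at
most one vertex removed, or misses at most `d - 1` vertices of `γ`. -/
lemma CollapsingTree.of_blocks {d : ℕ} (hd : 5 ≤ d) {𝓓 : Set (Finset V)} {γ : Finset V}
    (U : Bool → Finset V) (hdis : Disjoint (U true) (U false))
    (h𝓓 : ∀ D ∈ 𝓓, D ⊆ γ ∧ ((∃ c, D ⊆ U c ∧ (U c \ D).card ≤ 1) ∨ (γ \ D).card < d)) :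
    CollapsingTree d 𝓓 ∅ γ := by
  have hdis' : ∀ c c', c ≠ c' → Disjoint (U c) (U c') := by
    intro c c' hc
    cases c <;> cases c' <;> first | exact absurd rfl hc | exact hdis | exact hdis.symm
  -- Two phases: while block-type members of `𝓓` are being hit, `M` keeps at most two vertices in
  -- each block; afterwards all of them are hit and only the bound `d` is maintained.
  refine .of_invariant (fun M => M ⊆ γ ∧ ((M ⊆ U true ∪ U false ∧ ∀ c, (M ∩ U c).card ≤ 2) ∨
    (M.card ≤ d ∧ ∀ D ∈ 𝓓, (∃ c, D ⊆ U c ∧ (U c \ D).card ≤ 1) → ¬ Disjoint D M))) ?_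
    (Finset.empty_subset γ) ⟨Finset.empty_subset γ, .inl (by simp)⟩
  have second : ∀ M ⊆ γ, M.card ≤ d →
      (∀ D ∈ 𝓓, (∃ c, D ⊆ U c ∧ (U c \ D).card ≤ 1) → ¬ Disjoint D M) →
      (∀ D ∈ 𝓓, ¬ Disjoint D M) ∨ ∃ D ∈ 𝓓, Disjoint D M ∧ ∀ v ∈ D, insert v M ⊆ γ ∧
        (insert v M).card ≤ d ∧
        ∀ D' ∈ 𝓓, (∃ c, D' ⊆ U c ∧ (U c \ D').card ≤ 1) → ¬ Disjoint D' (insert v M) := by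
    intro M hM hcard hA
    by_cases hit : ∀ D ∈ 𝓓, ¬ Disjoint D M
    · exact .inl hit
    · push Not at hit
      obtain ⟨D, hD, hDM⟩ := hit
      refine .inr ⟨D, hD, hDM, fun v hv => ⟨Finset.insert_subset ((h𝓓 D hD).1 hv) hM, ?_,
        fun D' hD' hc h => hA D' hD' hc (h.mono_right (Finset.subset_insert v M))⟩⟩
      rcases (h𝓓 D hD).2 with hc | hc
      · exact absurd hDM (hA D hD hc)
      -- Missing `D` confines `M` to `γ \ D`, with fewer than `d` vertices, so there is room for one
      -- more.
      · have : M.card ≤ (γ \ D).card :=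
          Finset.card_le_card (Finset.subset_sdiff.mpr ⟨hM, hDM.symm⟩)
        have := Finset.card_insert_le v M
        omega
  rintro M ⟨hM, ⟨hMU, h2⟩ | ⟨hcard, hA⟩⟩
  · have hcard : M.card ≤ 4 := by
      have h₁ : M = (M ∩ U true) ∪ (M ∩ U false) := by
        rw [← Finset.inter_union_distrib_left, Finset.inter_eq_left.mpr hMU]
      have h₂ := Finset.card_union_le (M ∩ U true) (M ∩ U false)
      rw [← h₁] at h₂
      have := h2 true
      have := h2 false
      omega
    refine ⟨by omega, ?_⟩
    by_cases hA : ∀ D ∈ 𝓓, (∃ c, D ⊆ U c ∧ (U c \ D).card ≤ 1) → ¬ Disjoint D M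
    · rcases second M hM (by omega) hA with h | ⟨D, hD, hDM, h⟩
      · exact .inl h
      · exact .inr ⟨D, hD, hDM, fun v hv => ⟨(h v hv).1, .inr (h v hv).2⟩⟩
    · push Not at hA
      obtain ⟨D, hD, ⟨c, hDU, hc⟩, hDM⟩ := hA
      refine .inr ⟨D, hD, hDM, fun v hv => ⟨Finset.insert_subset ((h𝓓 D hD).1 hv) hM, .inl
        ⟨Finset.insert_subset ?_ hMU, fun c' => ?_⟩⟩⟩
      · have := hDU hv
        cases c <;> simp [this]
      · by_cases hcc : c' = c
        · subst hcc
          rw [Finset.insert_inter_of_mem (hDU hv)]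
          -- Before the insertion, `M` meets the block only outside `D`, hence in at most one
          -- vertex.
          have h₁ : (M ∩ U c').card ≤ (U c' \ D).card := Finset.card_le_card fun x hx => by
            rw [Finset.mem_inter] at hx
            exact Finset.mem_sdiff.mpr ⟨hx.2, fun h => Finset.disjoint_left.mp hDM h hx.1⟩
          have := Finset.card_insert_le v (M ∩ U c')
          omega
        · rw [Finset.insert_inter_of_notMem
            (Finset.disjoint_left.mp (hdis' c c' (Ne.symm hcc)) (hDU hv))]
          exact h2 c'
  · refine ⟨hcard, ?_⟩
    rcases second M hM hcard hA with h | ⟨D, hD, hDM, h⟩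
    · exact .inl h
    · exact .inr ⟨D, hD, hDM, fun v hv => ⟨(h v hv).1, .inr (h v hv).2⟩⟩

end Collapse

/-! ### Collapses as homotopy equivalences -/

section Homotopy

variable {V : Type*}

lemma subset_of_inf'_pos {σ δ : Finset V} (hσ : σ.Nonempty) {x : V → ℝ}
    (hδ : ∀ w, x w ≠ 0 → w ∈ δ) (h : 0 < σ.inf' hσ x) : σ ⊆ δ :=
  fun s hs => hδ s (h.trans_le (Finset.inf'_le x hs)).ne'

section

variable [Fintype V]

lemma realization_mono {X Y : PreAbstractSimplicialComplex V} (h : X.faces ⊆ Y.faces) :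
    realization X ⊆ realization Y :=
  fun _ ⟨hx, σ, hσ, hs⟩ => ⟨hx, σ, h hσ, hs⟩

lemma inf'_nonneg {σ : Finset V} (hσ : σ.Nonempty) {x : V → ℝ} (hx : x ∈ stdSimplex ℝ V) :
    0 ≤ σ.inf' hσ x :=
  Finset.le_inf' hσ x fun i _ => hx.1 i

end

variable [DecidableEq V]

/-- The map that pushes points away from the open star of `σ` towards the vertex `v`. -/
noncomputable def pushMap (σ : Finset V) (hσ : σ.Nonempty) (v : V) (x : V → ℝ) : V → ℝ :=
  fun w => x w - (if w ∈ σ then σ.inf' hσ x else 0) +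
    if w = v then (σ.card : ℝ) * σ.inf' hσ x else 0

lemma continuous_pushMap (σ : Finset V) (hσ : σ.Nonempty) (v : V) :
    Continuous (pushMap σ hσ v) := by
  have h : Continuous fun x : V → ℝ => σ.inf' hσ x :=
    Continuous.finset_inf'_apply hσ fun i _ => continuous_apply i
  refine continuous_pi fun w => ?_
  unfold pushMap
  refine ((continuous_apply w).sub ?_).add ?_
  · split_ifs <;> fun_prop
  · split_ifs <;> fun_prop

lemma pushMap_eq_self {σ : Finset V} (hσ : σ.Nonempty) (v : V) {x : V → ℝ}
    (h : σ.inf' hσ x = 0) : pushMap σ hσ v x = x := by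
  funext w
  simp [pushMap, h]

lemma pushMap_support {σ γ : Finset V} (hσ : σ.Nonempty) (hσγ : σ ⊆ γ) {v : V} (hv : v ∈ γ)
    {x : V → ℝ} (hx : ∀ w, x w ≠ 0 → w ∈ γ) (w : V) (hw : pushMap σ hσ v x w ≠ 0) : w ∈ γ := by
  by_contra hwγ
  refine hw ?_
  have h1 : x w = 0 := by
    by_contra h
    exact hwγ (hx w h)
  have h2 : w ∉ σ := fun h => hwγ (hσγ h)
  have h3 : w ≠ v := fun h => hwγ (h ▸ hv)
  simp [pushMap, h1, h2, h3]

/-- The coordinate attaining the minimum over `σ` drops to zero, so the image leaves the open star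
of `σ`. -/
lemma exists_pushMap_eq_zero {σ : Finset V} (hσ : σ.Nonempty) {v : V} (hv : v ∉ σ) (x : V → ℝ) :
    ∃ s ∈ σ, pushMap σ hσ v x s = 0 := by
  obtain ⟨s, hs, h⟩ := Finset.exists_mem_eq_inf' hσ x
  refine ⟨s, hs, ?_⟩
  have : s ≠ v := fun h => hv (h ▸ hs)
  simp [pushMap, hs, this, h]

variable [Fintype V]

lemma pushMap_mem_stdSimplex {σ : Finset V} (hσ : σ.Nonempty) (v : V) {x : V → ℝ}
    (hx : x ∈ stdSimplex ℝ V) : pushMap σ hσ v x ∈ stdSimplex ℝ V := by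
  have h0 := inf'_nonneg hσ hx
  refine ⟨fun w => ?_, ?_⟩
  · have h1 : 0 ≤ x w - (if w ∈ σ then σ.inf' hσ x else 0) := by
      split_ifs with hw
      · exact sub_nonneg.mpr (Finset.inf'_le x hw)
      · simpa using hx.1 w
    refine add_nonneg h1 ?_
    split_ifs <;> positivity
  · simp only [pushMap, Finset.sum_add_distrib, Finset.sum_sub_distrib, hx.2]
    simp

/-- Removing the interval `[σ, γ]`, where `γ` is the largest simplex over `σ` and `σ ≠ γ`, does not
change the homotopy type. -/
theorem nonempty_homotopyEquiv_of_collapse {X Y : PreAbstractSimplicialComplex V} {σ γ : Finset V}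
    (hσ : σ.Nonempty) (hσγ : σ ⊂ γ) (hγ : γ ∈ X.faces) (hmax : ∀ δ ∈ X.faces, σ ⊆ δ → δ ⊆ γ)
    (hY : Y.faces = {δ | δ ∈ X.faces ∧ ¬ (σ ⊆ δ ∧ δ ⊆ γ)}) :
    Nonempty (ContinuousMap.HomotopyEquiv (realization X) (realization Y)) := by
  obtain ⟨v, hvγ, hvσ⟩ := Finset.exists_of_ssubset hσγ
  have hYX : Y.faces ⊆ X.faces := fun δ hδ => by
    rw [hY] at hδ
    exact hδ.1
  have hpos : ∀ x ∈ realization X, 0 < σ.inf' hσ x → ∀ w, x w ≠ 0 → w ∈ γ := by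
    rintro x ⟨_, δ, hδ, hs⟩ h w hw
    exact hmax δ hδ (subset_of_inf'_pos hσ hs h) (hs w hw)
  have hpush : ∀ x ∈ realization X, pushMap σ hσ v x ∈ realization Y := by
    intro x hx
    have hstd := pushMap_mem_stdSimplex hσ v hx.1
    refine ⟨hstd, Finset.univ.filter (fun w => pushMap σ hσ v x w ≠ 0), ?_, fun w hw => by simpa⟩
    have hne : (Finset.univ.filter (fun w => pushMap σ hσ v x w ≠ 0)).Nonempty := by
      by_contra! h
      rw [Finset.filter_eq_empty_iff] at h
      have := hstd.2
      rw [Finset.sum_eq_zero fun w hw => not_not.mp (h hw)] at this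
      exact zero_ne_one this
    rw [hY]
    constructor
    · rcases (inf'_nonneg hσ hx.1).eq_or_lt with h | h
      · obtain ⟨_, δ, hδ, hs⟩ := hx
        refine mem_faces_of_subset hδ (fun w hw => hs w ?_) hne
        rw [pushMap_eq_self hσ v h.symm] at hw
        simpa using hw
      · refine mem_faces_of_subset hγ (fun w hw => ?_) hne
        exact pushMap_support hσ hσγ.1 hvγ (hpos x hx h) w (by simpa using hw)
    · rintro ⟨h, _⟩
      obtain ⟨s, hs, h0⟩ := exists_pushMap_eq_zero hσ hvσ x
      simpa [h0] using h hs
  have hfix : ∀ x ∈ realization Y, pushMap σ hσ v x = x := by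
    rintro x ⟨hx, δ, hδ, hs⟩
    rcases (inf'_nonneg hσ hx).eq_or_lt with h | h
    · exact pushMap_eq_self hσ v h.symm
    · rw [hY] at hδ
      have := subset_of_inf'_pos hσ hs h
      exact absurd ⟨this, hmax δ hδ.1 this⟩ hδ.2
  -- A moved point has its support in `γ`, and so does its image; the straight segment between them
  -- stays in that simplex.
  have hseg : ∀ x ∈ realization X, ∀ t : unitInterval,
      (1 - (t : ℝ)) • pushMap σ hσ v x + (t : ℝ) • x ∈ realization X := by
    intro x hx t
    rcases (inf'_nonneg hσ hx.1).eq_or_lt with h | h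
    · rw [pushMap_eq_self hσ v h.symm, ← add_smul]
      simpa using hx
    · refine ⟨convex_stdSimplex ℝ V (pushMap_mem_stdSimplex hσ v hx.1) hx.1
        (sub_nonneg.mpr t.2.2) t.2.1 (by ring), γ, hγ, fun w hw => ?_⟩
      by_contra hwγ
      refine hw ?_
      have h1 : x w = 0 := by
        by_contra h'
        exact hwγ (hpos x hx h w h')
      have h2 : pushMap σ hσ v x w = 0 := by
        by_contra h'
        exact hwγ (pushMap_support hσ hσγ.1 hvγ (hpos x hx h) w h')
      simp [h1, h2]
  have hcont := continuous_pushMap σ hσ v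
  let r : C(realization X, realization Y) :=
    ⟨fun x => ⟨pushMap σ hσ v x, hpush x x.2⟩, by fun_prop⟩
  let i : C(realization Y, realization X) :=
    ⟨fun x => ⟨x, realization_mono hYX x.2⟩, by fun_prop⟩
  refine ⟨⟨r, i, ⟨⟨⟨fun p => ⟨(1 - (p.1 : ℝ)) • pushMap σ hσ v p.2 + (p.1 : ℝ) • (p.2 : V → ℝ),
    hseg p.2 p.2.2 p.1⟩, by fun_prop⟩, fun x => ?_, fun x => ?_⟩⟩, ?_⟩⟩
  · ext1
    simp [r, i]
  · ext1
    simp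
  · have : r.comp i = ContinuousMap.id _ := by
      ext1 x
      exact Subtype.ext (hfix x x.2)
    rw [this]

/-- A complex `Z` containing `X`, all of whose further simplices have at most `d` vertices, is
homotopy equivalent to a subcomplex whose simplices have at most `d` vertices, if `X` can be
removed by pure collapses. -/
theorem exists_homotopyEquiv_of_pureCollapses {d : ℕ} (hd : 0 < d)
    {X : PreAbstractSimplicialComplex V} (h : ReflTransGen (IsPureCollapse d) X ⊥)
    (Z : PreAbstractSimplicialComplex V) (hXZ : X.faces ⊆ Z.faces)
    (hZ : ∀ δ ∈ Z.faces, δ ∉ X.faces → δ.card ≤ d) :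
    ∃ L : PreAbstractSimplicialComplex V, (∀ δ ∈ L.faces, δ.card ≤ d) ∧
      Nonempty (ContinuousMap.HomotopyEquiv (realization Z) (realization L)) := by
  induction h using ReflTransGen.head_induction_on generalizing Z with
  | refl => exact ⟨Z, fun δ hδ => hZ δ hδ id, ⟨.refl _⟩⟩
  | @head X Y hXY _ ih =>
    obtain ⟨σ, γ, hσγ, hγ, hmax, hcard, hY⟩ := hXY
    have hYX : Y.faces ⊆ X.faces := fun δ hδ => by
      rw [hY] at hδ
      exact hδ.1
    by_cases hne : σ = γ
    -- Deleting a single simplex could change the homotopy type, so it is kept in `Z` as one of the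
    -- small leftovers.
    · refine ih Z (hYX.trans hXZ) fun δ hδ hδY => ?_
      by_cases hδX : δ ∈ X.faces
      · have : σ ⊆ δ ∧ δ ⊆ γ := by
          by_contra h
          exact hδY (hY ▸ ⟨hδX, h⟩)
        have : δ = σ := (hne ▸ this.2).antisymm this.1
        rw [this]
        omega
      · exact hZ δ hδ hδX
    · have hσd : σ.card = d := by tauto
      -- A leftover simplex over `σ` has at most `d = σ.card` vertices, hence equals `σ`. Leftovers
      -- thus never obstruct a later collapse.
      have hmaxZ : ∀ δ ∈ Z.faces, σ ⊆ δ → δ ⊆ γ := fun δ hδ h => by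
        by_cases hδX : δ ∈ X.faces
        · exact hmax δ hδX h
        · rw [← Finset.eq_of_subset_of_card_le h (hσd ▸ hZ δ hδ hδX)]
          exact hσγ
      let W := deleteFaces Z {δ | σ ⊆ δ ∧ δ ⊆ γ} fun δ hδ τ hτ hδτ =>
        ⟨hδ.1.trans hδτ, hmaxZ τ hτ (hδ.1.trans hδτ)⟩
      obtain ⟨e⟩ := nonempty_homotopyEquiv_of_collapse (X := Z) (Y := W)
        (Finset.card_pos.mp (hσd ▸ hd)) (hσγ.ssubset_of_ne hne) (hXZ hγ) hmaxZ rfl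
      obtain ⟨L, hL, ⟨e'⟩⟩ := ih W (fun δ hδ => by
          rw [hY] at hδ
          exact ⟨hXZ hδ.1, hδ.2⟩) fun δ hδ hδY => by
        refine hZ δ hδ.1 fun hδX => hδY ?_
        rw [hY]
        exact ⟨hδX, hδ.2⟩
      exact ⟨L, hL, ⟨e.trans e'⟩⟩

end Homotopy

/-- Relabelling the vertices of a complex does not change its realization. -/
lemma nonempty_homeomorph_realization_map {V W : Type*} [Fintype V] [Fintype W] [DecidableEq W] (e : V ≃ W)
    (X : PreAbstractSimplicialComplex V) :
    Nonempty (realization X ≃ₜ realization (X.map e)) := by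
  have hsum : ∀ x : V → ℝ, ∑ w, x (e.symm w) = ∑ v, x v := fun x => e.symm.sum_comp x
  refine ⟨⟨⟨fun x => ⟨fun w => x.1 (e.symm w), ⟨fun w => x.2.1.1 _, ?_⟩, ?_⟩,
    fun y => ⟨fun v => y.1 (e v), ⟨fun v => y.2.1.1 _, ?_⟩, ?_⟩, fun x => ?_, fun y => ?_⟩,
    ?_, ?_⟩⟩
  · rw [hsum]; exact x.2.1.2
  · obtain ⟨x, hx, σ, hσ, hs⟩ := x
    exact ⟨σ.image e, ⟨σ, hσ, rfl⟩, fun w hw =>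
      Finset.mem_image.mpr ⟨e.symm w, hs _ hw, e.apply_symm_apply w⟩⟩
  · rw [e.sum_comp y.1]; exact y.2.1.2
  · obtain ⟨y, hy, _, ⟨σ, hσ, rfl⟩, hs⟩ := y
    refine ⟨σ, hσ, fun v hv => ?_⟩
    obtain ⟨u, hu, huv⟩ := Finset.mem_image.mp (hs _ hv)
    exact e.injective huv ▸ hu
  · ext; simp
  · ext; simp
  · have h : Continuous fun (x : V → ℝ) (w : W) => x (e.symm w) :=
      continuous_pi fun w => continuous_apply (e.symm w)
    exact (h.comp continuous_subtype_val).subtype_mk _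
  · have h : Continuous fun (y : W → ℝ) (v : V) => y (e v) :=
      continuous_pi fun v => continuous_apply (e v)
    exact (h.comp continuous_subtype_val).subtype_mk _

/-! ### Intersections and differences of edge stars -/

section Geometry

variable {ι : Type*} [Fintype ι] [DecidableEq ι]

/-- The strings within distance `1` of one of the endpoints of the edge through `u` in
direction `i`. -/
def edgeStar (u : ι → Bool) (i : ι) : Finset (ι → Bool) :=
  Finset.univ.filter fun w => ∀ j k, j ≠ i → k ≠ i → w j ≠ u j → w k ≠ u k → j = k

lemma mem_edgeStar {u w : ι → Bool} {i : ι} :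
    w ∈ edgeStar u i ↔ ∀ j k, j ≠ i → k ≠ i → w j ≠ u j → w k ≠ u k → j = k := by
  simp [edgeStar]

lemma mem_edgeStar_of_hammingDist_le_one {u v w : ι → Bool} {i : ι} (hw : hammingDist w v ≤ 1)
    (huv : ∀ j, j ≠ i → v j = u j) : w ∈ edgeStar u i := by
  rw [mem_edgeStar]
  intro j k hj hk hwj hwk
  exact Finset.card_le_one.mp hw j (by simpa [huv j hj] using hwj) k (by simpa [huv k hk] using hwk)

/-- The strings in `edgeStar u i` with value `c` in direction `i`, except for the endpoint of the
edge. -/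
def edgeStarSide (u : ι → Bool) (i : ι) (c : Bool) : Finset (ι → Bool) :=
  (edgeStar u i).filter fun w => w i = c ∧ ∃ j, j ≠ i ∧ w j ≠ u j

lemma card_edgeStar_inter_le {u v : ι → Bool} {i k j : ι} (hji : j ≠ i) (hjk : j ≠ k)
    (huv : u j ≠ v j) : (edgeStar u i ∩ edgeStar v k).card ≤ 4 := by
  -- At `j` the string differs from exactly one of `u` and `v`. This uses up the single deviation
  -- allowed by the corresponding star, so besides `w j` only the coordinate in that star's own
  -- direction is free.
  let φ : (ι → Bool) → Bool × Bool := fun w => (w j, if w j = u j then w k else w i)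
  have hinj : Set.InjOn φ (edgeStar u i ∩ edgeStar v k : Finset (ι → Bool)) := by
    intro w hw w' hw' h
    simp only [Finset.coe_inter, Set.mem_inter_iff, Finset.mem_coe, mem_edgeStar] at hw hw'
    simp only [φ, Prod.mk.injEq] at h
    obtain ⟨hj, h⟩ := h
    rw [← hj] at h
    funext l
    by_cases hwu : w j = u j
    · simp only [hwu, if_true] at h
      by_cases hlk : l = k
      · rw [hlk, h]
      by_cases hlj : l = j
      · rw [hlj, hj]
      have h1 : w l = v l := by
        by_contra hl
        exact hlj (hw.2 l j hlk hjk hl (hwu ▸ huv))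
      have h2 : w' l = v l := by
        by_contra hl
        exact hlj (hw'.2 l j hlk hjk hl (hj ▸ hwu ▸ huv))
      rw [h1, h2]
    · simp only [hwu, if_false] at h
      by_cases hli : l = i
      · rw [hli, h]
      by_cases hlj : l = j
      · rw [hlj, hj]
      have h1 : w l = u l := by
        by_contra hl
        exact hlj (hw.1 l j hli hji hl hwu)
      have h2 : w' l = u l := by
        by_contra hl
        exact hlj (hw'.1 l j hli hji hl (hj ▸ hwu))
      rw [h1, h2]
  have := Finset.card_le_card_of_injOn φ (fun _ _ => Finset.mem_coe.mpr (Finset.mem_univ _)) hinj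
  simpa using this

/-- A string outside the star of `v` deviates from `v` at two positions other than `k`. Off `i` it
may deviate from `u` only once, so one of the two positions is `i`. -/
lemma edgeStar_sdiff_subset {u v : ι → Bool} {i k : ι}
    (huv : ∀ j, j ≠ i → j ≠ k → u j = v j) :
    edgeStar u i \ edgeStar v k ⊆ edgeStarSide u i (!v i) := by
  intro w hw
  simp only [Finset.mem_sdiff, mem_edgeStar] at hw
  obtain ⟨hwu, hwv⟩ := hw
  push Not at hwv
  obtain ⟨a, b, hak, hbk, hwa, hwb, hab⟩ := hwv
  simp only [edgeStarSide, Finset.mem_filter, mem_edgeStar]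
  refine ⟨hwu, ?_⟩
  by_cases hai : a = i
  · have hbi : b ≠ i := fun h => hab (hai.trans h.symm)
    refine ⟨?_, b, hbi, huv b hbi hbk ▸ hwb⟩
    rw [hai] at hwa
    exact Bool.eq_not_of_ne hwa
  · have hwa' : w a ≠ u a := huv a hai hak ▸ hwa
    refine ⟨?_, a, hai, hwa'⟩
    have hbi : b = i := by
      by_contra hbi
      exact hab (hwu a b hai hbi hwa' (huv b hbi hbk ▸ hwb))
    rw [hbi] at hwb
    exact Bool.eq_not_of_ne hwb

/-- A string of the side that also lies in the star of `v` spends its deviation from `v` at `i`, so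
its deviation from `u` must be at `k`. This determines it. -/
lemma card_edgeStarSide_sdiff_le {u v : ι → Bool} {i k : ι} (hik : k ≠ i)
    (huv : ∀ j, j ≠ i → j ≠ k → u j = v j) :
    (edgeStarSide u i (!v i) \ (edgeStar u i \ edgeStar v k)).card ≤ 1 := by
  have key : ∀ w ∈ edgeStarSide u i (!v i) \ (edgeStar u i \ edgeStar v k),
      w i = (!v i) ∧ w k ≠ u k ∧ ∀ j, j ≠ i → j ≠ k → w j = u j := by
    intro w hw
    simp only [edgeStarSide, Finset.mem_sdiff, Finset.mem_filter, mem_edgeStar, not_and,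
      not_not] at hw
    obtain ⟨⟨hwu, hwi, j, hji, hwj⟩, h⟩ := hw
    have hwv := h hwu
    have hjk : j = k := by
      by_contra hjk
      exact hji (hwv j i hjk hik.symm (huv j hji hjk ▸ hwj) (by simp [hwi]))
    subst hjk
    refine ⟨hwi, hwj, fun l hli hlj => ?_⟩
    by_contra hl
    exact hlj (hwu l j hli hji hl hwj)
  refine Finset.card_le_one.mpr fun w hw w' hw' => ?_
  obtain ⟨h1, h2, h3⟩ := key w hw
  obtain ⟨h1', h2', h3'⟩ := key w' hw'
  funext l
  by_cases hli : l = i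
  · rw [hli, h1, h1']
  by_cases hlk : l = k
  · rw [hlk, Bool.eq_not_of_ne h2, Bool.eq_not_of_ne h2']
  rw [h3 l hli hlk, h3' l hli hlk]

lemma edgeStar_congr {u v : ι → Bool} {i : ι} (huv : ∀ j, j ≠ i → u j = v j) :
    edgeStar u i = edgeStar v i := by
  ext w
  simp only [mem_edgeStar]
  constructor
  · intro h j k hj hk hwj hwk
    exact h j k hj hk (huv j hj ▸ hwj) (huv k hk ▸ hwk)
  · intro h j k hj hk hwj hwk
    exact h j k hj hk (huv j hj ▸ hwj) (huv k hk ▸ hwk)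

variable (ι) in
/-- The vertex sets `edgeStar u i` for all edges of the hypercube. -/
def edgeStars : Finset (Finset (ι → Bool)) :=
  Finset.univ.image fun e : (ι → Bool) × ι => edgeStar e.1 e.2

lemma mem_edgeStars {γ : Finset (ι → Bool)} : γ ∈ edgeStars ι ↔ ∃ u i, edgeStar u i = γ := by
  simp [edgeStars]

theorem edgeStars_reflTransGen :
    ReflTransGen (IsPureCollapse 5) (generatedComplex (edgeStars ι)) ⊥ := by
  refine generatedComplex_reflTransGen _ fun γ hγ 𝓖 h𝓖 hn => ?_
  obtain ⟨u, i, rfl⟩ := mem_edgeStars.mp hγ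
  refine .of_blocks le_rfl (edgeStarSide u i) ?_ ?_
  · refine Finset.disjoint_left.mpr fun w hw hw' => ?_
    simp only [edgeStarSide, Finset.mem_filter] at hw hw'
    simp [hw.2.1] at hw'
  · rintro _ ⟨γ', hγ', rfl⟩
    obtain ⟨v, k, rfl⟩ := mem_edgeStars.mp (h𝓖 hγ')
    refine ⟨Finset.sdiff_subset, ?_⟩
    by_cases h : ∃ j, j ≠ i ∧ j ≠ k ∧ u j ≠ v j
    · obtain ⟨j, hji, hjk, huv⟩ := h
      refine .inr ?_
      dsimp only
      rw [sdiff_sdiff_right_self]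
      exact Nat.lt_succ_of_le (card_edgeStar_inter_le hji hjk huv)
    · push Not at h
      have hki : k ≠ i := by
        rintro rfl
        exact hn (edgeStar_congr (fun j hj => h j hj hj) ▸ hγ')
      exact .inl ⟨_, edgeStar_sdiff_subset h, card_edgeStarSide_sdiff_le hki h⟩

end Geometry

/-! ### The Čech complex is generated by edge stars -/

section Cech

variable {n : ℕ}

lemma hammingDist_le_length {u w : Fin n → Bool} (p : (hypercubeGraph n).Walk w u) :
    hammingDist w u ≤ p.length := by
  induction p with
  | nil => simp
  | @cons a b c h p ih =>
    have h1 : hammingDist a b = 1 := h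
    have := hammingDist_triangle a b c
    rw [SimpleGraph.Walk.length_cons]
    omega

lemma exists_walk_length_le_one {u w : Fin n → Bool} (h : hammingDist w u ≤ 1) :
    ∃ p : (hypercubeGraph n).Walk w u, p.length ≤ 1 := by
  rcases Nat.le_one_iff_eq_zero_or_eq_one.mp h with h | h
  · obtain rfl := hammingDist_eq_zero.mp h
    exact ⟨.nil, by simp⟩
  · have hadj : (hypercubeGraph n).Adj w u := h
    exact ⟨hadj.toWalk, by simp⟩

lemma exists_direction (hn : 0 < n) {a b : Fin n → Bool} (h : hammingDist a b ≤ 1) :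
    ∃ i, ∀ j, j ≠ i → b j = a j := by
  rcases Nat.le_one_iff_eq_zero_or_eq_one.mp h with h | h
  · obtain rfl := hammingDist_eq_zero.mp h
    exact ⟨⟨0, hn⟩, fun _ _ => rfl⟩
  · obtain ⟨i, hi⟩ := Finset.card_eq_one.mp h
    refine ⟨i, fun j hj => ?_⟩
    by_contra hne
    have : j ∈ ({i} : Finset (Fin n)) := by
      rw [← hi]
      simpa using Ne.symm hne
    exact hj (Finset.mem_singleton.mp this)

/-- A point of the realization of the hypercube graph lies on an edge. -/
lemma exists_edge_of_mem_graphRealization (hn : 0 < n) {x : (Fin n → Bool) → ℝ}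
    (hx : x ∈ graphRealization (hypercubeGraph n)) :
    ∃ (a : Fin n → Bool) (i : Fin n), ∀ u, x u ≠ 0 → ∀ j, j ≠ i → u j = a j := by
  obtain ⟨_, σ, hσ, hs⟩ := hx
  rcases hσ with ⟨v, rfl⟩ | ⟨e, he, rfl⟩
  · exact ⟨v, ⟨0, hn⟩, fun u hu j _ => by rw [Finset.mem_singleton.mp (hs u hu)]⟩
  · induction e using Sym2.ind with
    | _ a b =>
      have hab : hammingDist a b = 1 := he
      obtain ⟨i, hi⟩ := exists_direction hn hab.le
      refine ⟨a, i, fun u hu j hj => ?_⟩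
      have := hs u hu
      simp only [Sym2.mem_toFinset, Sym2.mem_iff] at this
      rcases this with rfl | rfl
      · rfl
      · exact hi j hj

/-- The midpoint of the edge through `u` in direction `i` lies within distance `3 / 2` of every
vertex of `edgeStar u i`. -/
lemma exists_mem_graphClosedBall (u : Fin n → Bool) (i : Fin n) :
    ∃ x, ∀ w ∈ edgeStar u i, x ∈ graphClosedBall (hypercubeGraph n) w (3 / 2) := by
  let e : Bool → Fin n → Bool := Function.update u i
  have hadj : hammingDist (e true) (e false) = 1 := by
    refine Finset.card_eq_one.mpr ⟨i, ?_⟩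
    ext j
    by_cases hj : j = i
    · subst hj; simp [e]
    · simp [e, hj]
  have hne : e true ≠ e false := fun h => by simp [h] at hadj
  let x : (Fin n → Bool) → ℝ := fun w =>
    (if w = e true then 1 / 2 else 0) + if w = e false then 1 / 2 else 0
  have hxe : ∀ c, x (e c) = 1 / 2 := by
    intro c
    cases c
    · simp [x, hne.symm]
    · simp [x, hne]
  have hx : x ∈ graphRealization (hypercubeGraph n) := by
    refine ⟨⟨fun w => ?_, ?_⟩, Sym2.toFinset s(e true, e false), .inr ⟨_, hadj, rfl⟩,
      fun w hw => ?_⟩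
    · simp only [x]
      split_ifs <;> norm_num
    · simp only [x, Finset.sum_add_distrib]
      simp
      norm_num
    · by_contra h
      simp only [Sym2.mem_toFinset, Sym2.mem_iff, not_or] at h
      simp [x, h.1, h.2] at hw
  -- The endpoint that agrees with `w` in direction `i` is within distance 1 of `w`; half an edge
  -- remains.
  refine ⟨x, fun w hw => ⟨hx, e (w i), by rw [hxe]; norm_num, ?_⟩⟩
  rw [mem_edgeStar] at hw
  have hd : hammingDist w (e (w i)) ≤ 1 := by
    refine Finset.card_le_one.mpr fun j hj k hk => ?_
    simp only [Finset.mem_filter, Finset.mem_univ, true_and, e] at hj hk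
    have hji : j ≠ i := by rintro rfl; simp at hj
    have hki : k ≠ i := by rintro rfl; simp at hk
    exact hw j k hji hki (by simpa [hji] using hj) (by simpa [hki] using hk)
  obtain ⟨p, hp⟩ := exists_walk_length_le_one hd
  refine ⟨p, ?_⟩
  have : (p.length : ℝ) ≤ 1 := by exact_mod_cast hp
  rw [hxe]
  linarith

theorem cechComplex_hypercubeGraph_eq (hn : 0 < n) :
    cechComplex (hypercubeGraph n) 3 = generatedComplex (edgeStars (Fin n)) := by
  ext δ
  constructor
  · rintro ⟨hne, x, hx⟩
    obtain ⟨w₀, hw₀⟩ := hne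
    obtain ⟨a, i, ha⟩ := exists_edge_of_mem_graphRealization hn (hx w₀ hw₀).1
    refine ⟨⟨w₀, hw₀⟩, edgeStar a i, mem_edgeStars.mpr ⟨a, i, rfl⟩, fun w hw => ?_⟩
    obtain ⟨hxr, u, hu, p, hp⟩ := hx w hw
    refine mem_edgeStar_of_hammingDist_le_one (v := u) ?_ (ha u hu.ne')
    have hxu : x u ≤ 1 := by
      rw [← hxr.1.2]
      exact Finset.single_le_sum (fun v _ => hxr.1.1 v) (Finset.mem_univ u)
    -- The length is at most `1 / 2 + x u ≤ 3 / 2`, and it is an integer.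
    have : (p.length : ℝ) < 2 := by linarith
    have : p.length < 2 := by exact_mod_cast this
    have := hammingDist_le_length p
    omega
  · rintro ⟨hne, γ, hγ, hδ⟩
    obtain ⟨u, i, rfl⟩ := mem_edgeStars.mp hγ
    obtain ⟨x, hx⟩ := exists_mem_graphClosedBall u i
    exact ⟨hne, x, fun w hw => hx w (hδ hw)⟩

end Cech

/-! ### A missing simplex in the 3-cube -/

section LowerBound

/-- The nonconstant strings of length `3`. -/
def nonconstantStrings : Finset (Fin 3 → Bool) :=
  Finset.univ.filter fun w => w 0 ≠ w 1 ∨ w 0 ≠ w 2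

lemma card_nonconstantStrings : nonconstantStrings.card = 6 := by decide

/-- In the 3-cube an edge star is the complement of the opposite edge. A nonconstant string is
adjacent to a constant one, and the star avoiding that edge contains the other nonconstant strings;
the two constant strings alone span no edge, so no star contains all six. -/
lemma erase_nonconstantStrings_subset : ∀ m ∈ nonconstantStrings,
    ∃ u i, nonconstantStrings.erase m ⊆ edgeStar u i := by
  decide

lemma not_nonconstantStrings_subset : ∀ u i, ¬ nonconstantStrings ⊆ edgeStar u i := by
  decide

end LowerBound

/-! ### Transfer of the missing simplex to dimension `n` -/

section MissingSimplex

variable {n : ℕ}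

/-- Extend a string of length `3` by zeros. -/
def extendString (n : ℕ) (w : Fin 3 → Bool) : Fin n → Bool :=
  fun j => if h : (j : ℕ) < 3 then w ⟨j, h⟩ else false

lemma extendString_castLE (hn : 3 ≤ n) (w : Fin 3 → Bool) (j : Fin 3) :
    extendString n w (Fin.castLE hn j) = w j := by
  simp [extendString]

lemma extendString_injective (hn : 3 ≤ n) : Function.Injective (extendString n) := by
  intro w w' h
  funext j
  rw [← extendString_castLE hn w, h, extendString_castLE]

lemma extendString_mem_edgeStar (hn : 3 ≤ n) {u w : Fin 3 → Bool} {i : Fin 3}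
    (h : w ∈ edgeStar u i) : extendString n w ∈ edgeStar (extendString n u) (Fin.castLE hn i) := by
  rw [mem_edgeStar] at h ⊢
  have key : ∀ j : Fin n, j ≠ Fin.castLE hn i → extendString n w j ≠ extendString n u j →
      ∃ j' : Fin 3, j = Fin.castLE hn j' ∧ j' ≠ i ∧ w j' ≠ u j' := by
    intro j hj hw
    by_cases hj3 : (j : ℕ) < 3
    · refine ⟨⟨j, hj3⟩, rfl, fun h => hj (h ▸ rfl), ?_⟩
      simpa [extendString, hj3] using hw
    · simp [extendString, hj3] at hw
  intro j k hj hk hwj hwk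
  obtain ⟨j', rfl, hj', hwj'⟩ := key j hj hwj
  obtain ⟨k', rfl, hk', hwk'⟩ := key k hk hwk
  rw [h j' k' hj' hk' hwj' hwk']

lemma exists_mem_edgeStar_of_extendString (hn : 3 ≤ n) (u : Fin n → Bool) (i : Fin n) :
    ∃ (u' : Fin 3 → Bool) (i' : Fin 3), ∀ w, extendString n w ∈ edgeStar u i →
      w ∈ edgeStar u' i' := by
  obtain ⟨i', hi'⟩ : ∃ i' : Fin 3, ∀ j, j ≠ i' → Fin.castLE hn j ≠ i := by
    by_cases hi : (i : ℕ) < 3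
    · refine ⟨⟨i, hi⟩, ?_⟩
      rintro j hj rfl
      exact hj rfl
    -- The direction `i` is invisible in the first three coordinates, so any direction of the 3-cube
    -- serves.
    · refine ⟨0, ?_⟩
      rintro j _ rfl
      exact hi j.2
  refine ⟨fun j => u (Fin.castLE hn j), i', fun w hw => ?_⟩
  rw [mem_edgeStar] at hw ⊢
  intro j k hj hk hwj hwk
  exact Fin.castLE_injective hn (hw _ _ (hi' j hj) (hi' k hk)
    (by rwa [extendString_castLE]) (by rwa [extendString_castLE]))

lemma five_le_of_isCollapsible (hn : 3 ≤ n) {d : ℕ}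
    (h : IsCollapsible d (generatedComplex (edgeStars (Fin n)))) : 5 ≤ d := by
  have hinj := extendString_injective hn
  have hcard : (nonconstantStrings.image (extendString n)).card = 6 := by
    rw [Finset.card_image_of_injective _ hinj, card_nonconstantStrings]
  have hle := h.card_le_of_missing (τ := nonconstantStrings.image (extendString n)) ?_ ?_ ?_
  · omega
  · rintro ⟨_, γ, hγ, hsub⟩
    obtain ⟨u, i, rfl⟩ := mem_edgeStars.mp hγ
    obtain ⟨u', i', h'⟩ := exists_mem_edgeStar_of_extendString hn u i
    exact not_nonconstantStrings_subset u' i' fun w hw =>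
      h' w (hsub (Finset.mem_image_of_mem _ hw))
  · exact Finset.card_pos.mp (by omega)
  · intro a ha
    have hne : ((nonconstantStrings.image (extendString n)).erase a).Nonempty := by
      rw [← Finset.card_pos, Finset.card_erase_of_mem ha]
      omega
    obtain ⟨m, hm, rfl⟩ := Finset.mem_image.mp ha
    obtain ⟨u, i, hsub⟩ := erase_nonconstantStrings_subset m hm
    refine ⟨hne, _, mem_edgeStars.mpr ⟨extendString n u, Fin.castLE hn i, rfl⟩, ?_⟩
    rw [← Finset.image_erase hinj]
    intro x hx
    obtain ⟨w, hw, rfl⟩ := Finset.mem_image.mp hx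
    exact extendString_mem_edgeStar hn (hsub hw)

end MissingSimplex

end CechHypercube

theorem mainTheorem4 (n : ℕ) (hn : 4 ≤ n) :
    CechHypercube.IsCollapsibilityNumber
        (CechHypercube.cechComplex (CechHypercube.hypercubeGraph n) 3) 5 ∧
      ∃ (m : ℕ) (L : PreAbstractSimplicialComplex (Fin m)),
        CechHypercube.DimensionAtMost L 4 ∧
          Nonempty (ContinuousMap.HomotopyEquiv
            (CechHypercube.realization
              (CechHypercube.cechComplex (CechHypercube.hypercubeGraph n) 3))
            (CechHypercube.realization L)) := by
  rw [CechHypercube.cechComplex_hypercubeGraph_eq (by omega)]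
  have hcol := CechHypercube.edgeStars_reflTransGen (ι := Fin n)
  refine ⟨⟨Relation.ReflTransGen.mono (fun _ _ h => h.isElementaryCollapse) _ _ hcol,
    fun d hd => CechHypercube.five_le_of_isCollapsible (by omega) hd⟩, ?_⟩
  -- The process starts with `Z` equal to the whole complex, so there are no leftovers yet.
  obtain ⟨L, hL, ⟨e⟩⟩ := CechHypercube.exists_homotopyEquiv_of_pureCollapses (by norm_num) hcol _
    subset_rfl fun δ hδ hδ' => absurd hδ hδ'
  obtain ⟨e'⟩ := CechHypercube.nonempty_homeomorph_realization_map
    (Fintype.equivFin (Fin n → Bool)) L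
  refine ⟨_, _, ?_, ⟨e.trans e'.toHomotopyEquiv⟩⟩
  rintro _ ⟨σ, hσ, rfl⟩
  exact Finset.card_image_le.trans (hL σ hσ)
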